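/- Let $\mathbb F$ be a field of characteristic $p>0$, let $m\ge 1$, and let $\lambda=(\lambda_1,\dots,\lambda_m)\in(\mathbb F^\times)^m$. The twisted Heisenberg Lie algebra $\mathfrak h_m^\lambda$ is the $(2m+2)$-dimensional Lie algebra over $\mathbb F$ with basis $e_1,\dots,e_{2m+2}$ and brackets $$[e_i,e_{m+i}]=e_{2m+1},\qquad [e_{2m+2},e_i]=\lambda_i e_{m+i},\qquad [e_{2m+2},e_{m+i}]=\lambda_i e_i\qquad(1\le i\le m),$$ all brackets of pairs of basis vectors not determined by these and antisymmetry being zero. A Lie algebra $\mathfrak g$ over $\mathbb F$ is called restrictable if it admits a $[p]$-operator, i.e. a map $g\mapsto g^{[p]}$ from $\mathfrak g$ to itself such that for all $a\in\mathbb F$ and $g,h\in\mathfrak g$: (1) $(ag)^{[p]}=a^pg^{[p]}$; (2) $(g+h)^{[p]}=g^{[p]}+h^{[p]}+\sum_{i=1}^{p-1}s_i(g,h)$, where $i\,s_i(g,h)$ is the coefficient of $t^{i-1}$ in the formal expression $(\operatorname{ad}(tg+h))^{p-1}(g)$; (3) $(\operatorname{ad} g)^p=\operatorname{ad}(g^{[p]})$.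 Theorem. $\mathfrak h_m^\lambda$ is restrictable if and only if $p>2$ and $\lambda_1^{p-1}=\cdots=\lambda_m^{p-1}$. -/

import Mathlib

open scoped TensorProduct

/-! ### Restricted Lie algebras -/

section Restricted

variable (F : Type*) [Field F] {L : Type*} [LieRing L] [LieAlgebra F L]

/-- The `F`-linear map `F[t] ⊗ L → L` sending `∑ tⁿ ⊗ xₙ` to the coefficient `xₙ` of `tⁿ`. -/
noncomputable def tCoeff (n : ℕ) : Polynomial F ⊗[F] L →ₗ[F] L :=
  (TensorProduct.lid F L).toLinearMap ∘ₗ LinearMap.rTensor L (Polynomial.lcoeff F n)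

/-- The element `(ad (t g + h))ᵖ⁻¹ (g)` of the Lie algebra `F[t] ⊗ L` over `F[t]`. -/
noncomputable def adPowPoly (p : ℕ) (g h : L) : Polynomial F ⊗[F] L :=
  ((LieAlgebra.ad (Polynomial F) (Polynomial F ⊗[F] L)
    ((Polynomial.X : Polynomial F) ⊗ₜ[F] g + (1 : Polynomial F) ⊗ₜ[F] h)) ^ (p - 1))
    ((1 : Polynomial F) ⊗ₜ[F] g)

/-- `sᵢ(g, h)`: `i sᵢ(g, h)` is the coefficient of `tⁱ⁻¹` in `(ad (t g + h))ᵖ⁻¹ (g)`.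
It is used for `1 ≤ i ≤ p - 1` in characteristic `p`, where `i` is invertible in `F`. -/
noncomputable def jacobsonS (p i : ℕ) (g h : L) : L :=
  (i : F)⁻¹ • tCoeff F (i - 1) (adPowPoly F p g h)

/-- `φ : L → L` is a `[p]`-operator on the Lie algebra `L` over `F`, a field of
characteristic `p`. -/
structure IsPOperator (p : ℕ) (φ : L → L) : Prop where
  map_smul : ∀ (a : F) (g : L), φ (a • g) = a ^ p • φ g
  map_add : ∀ g h : L,
    φ (g + h) = φ g + φ h + ∑ i ∈ Finset.Icc 1 (p - 1), jacobsonS F p i g h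
  ad_pow : ∀ g : L, LieAlgebra.ad F L g ^ p = LieAlgebra.ad F L (φ g)

variable (L) in
/-- A Lie algebra is restrictable if it admits a `[p]`-operator. -/
def IsRestrictable (p : ℕ) : Prop := ∃ φ : L → L, IsPOperator F p φ

end Restricted

/-! ### The twisted Heisenberg Lie algebra -/

/-- The twisted Heisenberg Lie algebra with parameters `lam : Fin m → Fˣ`. The element
`⟨x, y, z, t⟩` stands for
`∑ i, xᵢ eᵢ + ∑ i, yᵢ e_{m+i} + z e_{2m+1} + t e_{2m+2}` (`1 ≤ i ≤ m`). -/
@[ext] structure TwistedHeisenberg (F : Type*) [Field F] (m : ℕ) (lam : Fin m → Fˣ) where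
  /-- coordinates along `e₁, …, e_m` -/
  x : Fin m → F
  /-- coordinates along `e_{m+1}, …, e_{2m}` -/
  y : Fin m → F
  /-- coordinate along `e_{2m+1}` -/
  z : F
  /-- coordinate along `e_{2m+2}` -/
  t : F

namespace TwistedHeisenberg

variable {F : Type*} [Field F] {m : ℕ} {lam : Fin m → Fˣ}

/-- The coordinates of an element. -/
def coords : TwistedHeisenberg F m lam ≃ (Fin m → F) × (Fin m → F) × F × F where
  toFun a := (a.x, a.y, a.z, a.t)
  invFun a := ⟨a.1, a.2.1, a.2.2.1, a.2.2.2⟩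
  left_inv _ := rfl
  right_inv _ := rfl

instance : AddCommGroup (TwistedHeisenberg F m lam) := coords.addCommGroup

instance : Module F (TwistedHeisenberg F m lam) := coords.module F

@[simp] theorem zero_x : (0 : TwistedHeisenberg F m lam).x = 0 := rfl
@[simp] theorem zero_y : (0 : TwistedHeisenberg F m lam).y = 0 := rfl
@[simp] theorem zero_z : (0 : TwistedHeisenberg F m lam).z = 0 := rfl
@[simp] theorem zero_t : (0 : TwistedHeisenberg F m lam).t = 0 := rfl
@[simp] theorem add_x (a b : TwistedHeisenberg F m lam) : (a + b).x = a.x + b.x := rfl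
@[simp] theorem add_y (a b : TwistedHeisenberg F m lam) : (a + b).y = a.y + b.y := rfl
@[simp] theorem add_z (a b : TwistedHeisenberg F m lam) : (a + b).z = a.z + b.z := rfl
@[simp] theorem add_t (a b : TwistedHeisenberg F m lam) : (a + b).t = a.t + b.t := rfl
@[simp] theorem smul_x (c : F) (a : TwistedHeisenberg F m lam) : (c • a).x = c • a.x := rfl
@[simp] theorem smul_y (c : F) (a : TwistedHeisenberg F m lam) : (c • a).y = c • a.y := rfl
@[simp] theorem smul_z (c : F) (a : TwistedHeisenberg F m lam) : (c • a).z = c * a.z := rfl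
@[simp] theorem smul_t (c : F) (a : TwistedHeisenberg F m lam) : (c • a).t = c * a.t := rfl

/-- The bilinear alternating extension of
`[eᵢ, e_{m+i}] = e_{2m+1}`, `[e_{2m+2}, eᵢ] = λᵢ e_{m+i}`, `[e_{2m+2}, e_{m+i}] = λᵢ eᵢ`,
the brackets of all other pairs of basis vectors being zero. -/
instance : Bracket (TwistedHeisenberg F m lam) (TwistedHeisenberg F m lam) where
  bracket a b :=
    { x := fun i => lam i * (a.t * b.y i - b.t * a.y i)
      y := fun i => lam i * (a.t * b.x i - b.t * a.x i)
      z := ∑ i, (a.x i * b.y i - a.y i * b.x i)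
      t := 0 }

@[simp] theorem lie_x (a b : TwistedHeisenberg F m lam) (i : Fin m) :
    ⁅a, b⁆.x i = lam i * (a.t * b.y i - b.t * a.y i) := rfl
@[simp] theorem lie_y (a b : TwistedHeisenberg F m lam) (i : Fin m) :
    ⁅a, b⁆.y i = lam i * (a.t * b.x i - b.t * a.x i) := rfl
@[simp] theorem lie_z (a b : TwistedHeisenberg F m lam) :
    ⁅a, b⁆.z = ∑ i, (a.x i * b.y i - a.y i * b.x i) := rfl
@[simp] theorem lie_t (a b : TwistedHeisenberg F m lam) : ⁅a, b⁆.t = 0 := rfl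

instance : LieRing (TwistedHeisenberg F m lam) where
  add_lie a b c := by
    ext <;> simp [← Finset.sum_add_distrib, -Finset.sum_sub_distrib] <;>
      first | ring1 | exact Finset.sum_congr rfl fun i _ => by ring1
  lie_add a b c := by
    ext <;> simp [← Finset.sum_add_distrib, -Finset.sum_sub_distrib] <;>
      first | ring1 | exact Finset.sum_congr rfl fun i _ => by ring1
  lie_self a := by
    ext <;> simp [mul_comm]
  leibniz_lie a b c := by
    ext <;> simp [← Finset.sum_add_distrib, -Finset.sum_sub_distrib] <;>
      first | ring1 | exact Finset.sum_congr rfl fun i _ => by ring1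

instance : LieAlgebra F (TwistedHeisenberg F m lam) where
  lie_smul c a b := by
    ext <;> simp [Finset.mul_sum, -Finset.sum_sub_distrib] <;>
      first | ring1 | exact Finset.sum_congr rfl fun i _ => by ring1

end TwistedHeisenberg

-- Write `D` for the map of `V = F^m × F^m` induced by `ad e_{2m+2}`; it swaps `eᵢ` and `e_{m+i}`
-- with factor `λᵢ`. Necessity: `(ad e_{2m+2})^p` must be some `ad g`. On `V`, modulo the centre,
-- `ad g` is `g.t • D`. For odd `p`, comparing with `D^p` forces `λᵢ^(p-1) = g.t` for every `i`; for
-- `p = 2`, `D²` is diagonal and nonzero, while `D` is off-diagonal. Sufficiency: p-th powers in an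
-- associative algebra of characteristic `p` satisfy Jacobson's formula, so a faithful
-- representation whose image is closed under them yields a `[p]`-operator
-- (`LieHom.isPOperator_of_injective`). `symplecticRep` is such a representation: it is faithful for
-- `p ≠ 2`, and closed because `D^(p-1)` is scalar.

attribute [local instance] LieRing.ofAssociativeRing

/-! ### Jacobson's formula in associative algebras of characteristic `p` -/

section Jacobson

theorem Nat.Prime.cast_choose_pred {R : Type*} [Ring R] {p : ℕ} (hp : p.Prime) [CharP R p]
    {k : ℕ} (hk : k < p) : ((p - 1).choose k : R) = (-1) ^ k := by
  induction k with
  | zero => simp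
  | succ k ih =>
    have h : p.choose (k + 1) = (p - 1).choose k + (p - 1).choose (k + 1) := by
      conv_lhs => rw [← Nat.sub_add_cancel hp.one_le]
      exact Nat.choose_succ_succ _ _
    have h0 : (p.choose (k + 1) : R) = 0 :=
      (CharP.cast_eq_zero_iff R p _).2 (hp.dvd_choose_self (Nat.succ_ne_zero k) hk)
    rw [h, Nat.cast_add, ih (by omega)] at h0
    rw [pow_succ, mul_neg_one]
    exact eq_neg_of_add_eq_zero_right h0

/-- The binomial signs cancel those of `(-b)^(p-1-k)`, since `(-1)^(p-1) = 1` in `R`, even for `p =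
2`. -/
theorem Commute.sub_pow_char_pred {R : Type*} [Ring R] {p : ℕ} (hp : p.Prime) [CharP R p]
    {a b : R} (h : Commute a b) :
    (a - b) ^ (p - 1) = ∑ k ∈ Finset.range p, a ^ k * b ^ (p - 1 - k) := by
  have := Fact.mk hp
  have hneg : (-1 : R) ^ (p - 1) = 1 := by
    have h1 : (-1 : R) ^ (p - 1 + 1) = -1 := by
      rw [Nat.sub_add_cancel hp.one_le]; exact neg_one_pow_char R p
    rw [pow_succ, mul_neg_one, neg_inj] at h1
    exact h1
  rw [sub_eq_add_neg, h.neg_right.add_pow, Nat.sub_add_cancel hp.one_le]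
  refine Finset.sum_congr rfl fun k hk => ?_
  have hk' : k < p := Finset.mem_range.1 hk
  rw [hp.cast_choose_pred hk', neg_pow b, mul_assoc, mul_assoc]
  congr 1
  have hc : Commute (b ^ (p - 1 - k)) ((-1 : R) ^ k) :=
    ((Commute.neg_one_right b).pow_right k).pow_left _
  rw [hc.eq, ← mul_assoc, ← pow_add, Nat.sub_add_cancel (by omega), hneg, one_mul]

variable {F A : Type*} [Field F] [Ring A] [Algebra F A] {p : ℕ} [CharP F p]

theorem Module.End.charP_of_algebra (F A : Type*) [Field F] [Ring A] [Algebra F A] [Nontrivial A]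
    (p : ℕ) [CharP F p] : CharP (Module.End F A) p :=
  charP_of_injective_algebraMap (algebraMap F (Module.End F A)).injective p

theorem LieAlgebra.ad_pow_char_of_associative (hp : p.Prime) (a : A) :
    LieAlgebra.ad F A a ^ p = LieAlgebra.ad F A (a ^ p) := by
  nontriviality A
  have := Fact.mk hp
  have := Module.End.charP_of_algebra F A p
  rw [LieAlgebra.ad_eq_lmul_left_sub_lmul_right, Pi.sub_apply, Pi.sub_apply,
    sub_pow_char_of_commute (p := p) (LinearMap.commute_mulLeft_right a a),
    LinearMap.pow_mulLeft, LinearMap.pow_mulRight]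

theorem LieAlgebra.ad_pow_char_pred_apply (hp : p.Prime) (a b : A) :
    (LieAlgebra.ad F A a ^ (p - 1)) b =
      ∑ k ∈ Finset.range p, a ^ k * b * a ^ (p - 1 - k) := by
  nontriviality A
  have := Module.End.charP_of_algebra F A p
  rw [LieAlgebra.ad_eq_lmul_left_sub_lmul_right, Pi.sub_apply,
    (LinearMap.commute_mulLeft_right a a).sub_pow_char_pred hp]
  simp [LinearMap.pow_mulLeft, LinearMap.pow_mulRight, mul_assoc]

end Jacobson

/-! ### Powers of polynomials over a noncommutative ring -/

namespace Polynomial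

theorem derivative_pow_eq_sum {A : Type*} [Ring A] (f : A[X]) (n : ℕ) :
    derivative (f ^ n) = ∑ k ∈ Finset.range n, f ^ k * derivative f * f ^ (n - 1 - k) := by
  induction n with
  | zero => simp
  | succ n ih =>
    rw [pow_succ, derivative_mul, ih, Finset.sum_range_succ, Finset.sum_mul]
    congr 1
    · refine Finset.sum_congr rfl fun k hk => ?_
      have : k < n := Finset.mem_range.1 hk
      rw [mul_assoc, ← pow_succ, show n - 1 - k + 1 = n + 1 - 1 - k by omega]
    · simp

theorem sum_coeff_linear_pow {A : Type*} [Ring A] (a b : A) {n : ℕ} (hn : n ≠ 0) :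
    (a + b) ^ n = a ^ n + b ^ n +
      ∑ i ∈ Finset.Icc 1 (n - 1), ((C a * X + C b) ^ n).coeff i := by
  have hd : (C a * X + C b).natDegree ≤ 1 := natDegree_linear_le
  -- Evaluation is multiplicative only at central points; `0` and `1` suffice.
  have heval (c : A) (hc : ∀ x : A, Commute x c) :
      eval c ((C a * X + C b) ^ n) = (a * c + b) ^ n := by
    have : eval c ((C a * X + C b) ^ n) = eval c (C a * X + C b) ^ n :=
      map_pow (eval₂RingHom' (RingHom.id A) c hc) _ n
    rw [this, eval_add, eval_mul_X, eval_C, eval_C]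
  have hs : (a + b) ^ n = ∑ i ∈ Finset.range (n + 1), ((C a * X + C b) ^ n).coeff i := by
    rw [← mul_one a, ← heval 1 Commute.one_right, mul_one, eval_eq_sum_range' (n := n + 1)
      (Nat.lt_succ_of_le ((natDegree_pow_le_of_le n hd).trans_eq (mul_one n)))]
    simp
  rw [hs]
  have h0 : ((C a * X + C b) ^ n).coeff 0 = b ^ n := by
    
    rw [coeff_zero_eq_eval_zero, heval 0 Commute.zero_right, mul_zero, zero_add]
  have h1 : ((C a * X + C b) ^ n).coeff n = a ^ n := by
    simpa using coeff_pow_of_natDegree_le (m := n) hd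
  obtain ⟨n, rfl⟩ := Nat.exists_eq_succ_of_ne_zero hn
  rw [Finset.sum_range_succ, h1, Finset.range_eq_Ico, Finset.sum_eq_sum_Ico_succ_bot (by omega), h0,
    add_comm, add_assoc]
  rfl

end Polynomial

/-! ### Jacobson's formula through a representation -/

section Representation

open Polynomial

variable {F : Type*} [Field F] {L : Type*} [LieRing L] [LieAlgebra F L]
  {A : Type*} [Ring A] [Algebra F A]

theorem Polynomial.commute_map_algebraMap (f : F[X]) (q : A[X]) :
    Commute (f.map (algebraMap F A)) q := by
  induction f using Polynomial.induction_on' with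
  | add f g hf hg => rw [Polynomial.map_add]; exact hf.add_left hg
  | monomial n a =>
    rw [map_monomial, ← C_mul_X_pow_eq_monomial]
    exact Commute.mul_left (Algebra.commutes (A := A[X]) a q)
      (commute_X_pow q n)

/-- The map `F[t] ⊗ L → A[t]` induced by a representation `ρ : L → A` in an associative
algebra. -/
noncomputable def LieHom.toPolynomial (ρ : L →ₗ⁅F⁆ A) : F[X] ⊗[F] L →ₗ[F] A[X] :=
  TensorProduct.lift (LinearMap.mk₂ F (fun f x => f.map (algebraMap F A) * C (ρ x))
    (fun f g x => by rw [Polynomial.map_add, add_mul])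
    (fun c f x => by
      rw [smul_eq_C_mul, Polynomial.map_mul, map_C, mul_assoc, Algebra.smul_def]; rfl)
    (fun f x y => by rw [map_add, C_add, mul_add])
    (fun c f x => by rw [map_smul, ← smul_C, mul_smul_comm]))

namespace LieHom

variable (ρ : L →ₗ⁅F⁆ A)

@[simp] theorem toPolynomial_tmul (f : F[X]) (x : L) :
    ρ.toPolynomial (f ⊗ₜ x) = f.map (algebraMap F A) * C (ρ x) := rfl

theorem toPolynomial_lie (u v : F[X] ⊗[F] L) :
    ρ.toPolynomial ⁅u, v⁆ = ⁅ρ.toPolynomial u, ρ.toPolynomial v⁆ := by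
  induction u with
  | zero => rw [show ⁅(0 : F[X] ⊗[F] L), v⁆ = 0 from zero_lie v, map_zero, zero_lie]
  | add u u' hu hu' =>
    rw [show ⁅u + u', v⁆ = ⁅u, v⁆ + ⁅u', v⁆ from add_lie u u' v, map_add, map_add, hu, hu', add_lie]
  | tmul f x =>
    induction v with
    | zero => rw [show ⁅f ⊗ₜ[F] x, (0 : F[X] ⊗[F] L)⁆ = 0 from lie_zero (f ⊗ₜ[F] x), map_zero, lie_zero]
    | add v v' hv hv' =>
      rw [show ⁅f ⊗ₜ[F] x, v + v'⁆ = ⁅f ⊗ₜ[F] x, v⁆ + ⁅f ⊗ₜ[F] x, v'⁆ from lie_add (f ⊗ₜ[F] x) v v',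
        map_add, map_add, hv, hv', lie_add]
    | tmul g y =>
      rw [LieAlgebra.ExtendScalars.bracket_tmul]
      simp only [toPolynomial_tmul, map_lie, Ring.lie_def, Polynomial.map_mul, C_sub, C_mul]
      have h1 := (commute_map_algebraMap g (C (ρ x))).eq
      have h2 := (commute_map_algebraMap f (C (ρ y))).eq
      have h3 := (commute_map_algebraMap f (g.map (algebraMap F A))).eq
      rw [mul_sub]
      congr 1
      · rw [mul_assoc, ← mul_assoc _ (C (ρ x)), h1]; simp only [mul_assoc]
      · rw [h3, mul_assoc, ← mul_assoc _ (C (ρ y)), h2]; simp only [mul_assoc]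

theorem coeff_toPolynomial (n : ℕ) (u : F[X] ⊗[F] L) :
    (ρ.toPolynomial u).coeff n = ρ (tCoeff F n u) := by
  induction u with
  | zero => simp
  | add u v hu hv => simp only [map_add, coeff_add, hu, hv]
  | tmul f x => simp [tCoeff, Algebra.smul_def]

theorem toPolynomial_adPowPoly (p : ℕ) (g h : L) :
    ρ.toPolynomial (adPowPoly F p g h) =
      (LieAlgebra.ad F A[X] (C (ρ g) * X + C (ρ h)) ^ (p - 1)) (C (ρ g)) := by
  unfold adPowPoly
  induction p - 1 with
  | zero => simp
  | succ n ih =>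
    rw [pow_succ', pow_succ', Module.End.mul_apply, Module.End.mul_apply, LieAlgebra.ad_apply,
      LieAlgebra.ad_apply, toPolynomial_lie, ih]
    congr 1
    simp [X_mul_C]

/-- With `f = at + b`, the derivative of `f^p` is `∑ f^k a f^(p-1-k) = (ad f)^(p-1) a`; compare
coefficients of `t^(i-1)`. -/
theorem map_jacobsonS {p : ℕ} (hp : p.Prime) [CharP F p] {i : ℕ} (hi : 1 ≤ i) (hip : i < p)
    (g h : L) : ρ (jacobsonS F p i g h) = ((C (ρ g) * X + C (ρ h)) ^ p).coeff i := by
  have hd : derivative (C (ρ g) * X + C (ρ h)) = C (ρ g) := by simp [derivative_mul]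
  have hi0 : (i : F) ≠ 0 := by
    rw [Ne, CharP.cast_eq_zero_iff F p]
    exact Nat.not_dvd_of_pos_of_lt hi hip
  have hder := derivative_pow_eq_sum (C (ρ g) * X + C (ρ h)) p
  rw [hd, ← LieAlgebra.ad_pow_char_pred_apply (F := F) hp, ← toPolynomial_adPowPoly] at hder
  rw [jacobsonS, map_smul, ← coeff_toPolynomial, ← hder, coeff_derivative,
    Nat.sub_add_cancel hi, inv_smul_eq_iff₀ hi0, Algebra.smul_def, map_natCast,
    ← Nat.cast_add_one, Nat.sub_add_cancel hi, Nat.cast_comm]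

/-- If a Lie algebra is faithfully represented in an associative algebra of characteristic `p`
and its image is closed under `p`-th powers, then these define a `[p]`-operator. -/
theorem isPOperator_of_injective {p : ℕ} (hp : p.Prime) [CharP F p]
    (hρ : Function.Injective ρ) {φ : L → L} (hφ : ∀ g, ρ (φ g) = ρ g ^ p) :
    IsPOperator F p φ where
  map_smul a g := hρ <| by rw [hφ, map_smul, map_smul, hφ, _root_.smul_pow]
  map_add g h := hρ <| by
    rw [hφ, map_add, map_add, map_add, hφ, hφ, sum_coeff_linear_pow _ _ hp.ne_zero, map_sum]
    congr 1
    refine Finset.sum_congr rfl fun i hi => ?_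
    obtain ⟨h1, h2⟩ := Finset.mem_Icc.1 hi
    exact (ρ.map_jacobsonS hp h1 (by have := hp.pos; omega) g h).symm
  ad_pow g := by
    have key (n : ℕ) (x : L) :
        ρ ((LieAlgebra.ad F L g ^ n) x) = (LieAlgebra.ad F A (ρ g) ^ n) (ρ x) := by
      induction n with
      | zero => rfl
      | succ n ih => simp only [pow_succ', Module.End.mul_apply, LieAlgebra.ad_apply, map_lie, ih]
    refine LinearMap.ext fun x => hρ ?_
    rw [key, LieAlgebra.ad_pow_char_of_associative hp, LieAlgebra.ad_apply, LieAlgebra.ad_apply,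
      map_lie, hφ]

end LieHom

end Representation

/-! ### The symplectic representation and its p-th powers -/

namespace TwistedHeisenberg

variable {F : Type*} [Field F] {m : ℕ} {lam : Fin m → Fˣ}

/-- The element `e_{2m+2}`. -/
def derivationElement : TwistedHeisenberg F m lam := ⟨0, 0, 0, 1⟩

theorem ad_derivationElement_pow_even (k : ℕ) (u : Fin m → F) :
    (LieAlgebra.ad F (TwistedHeisenberg F m lam) derivationElement ^ (2 * k)) ⟨u, 0, 0, 0⟩ =
      ⟨fun i => (lam i : F) ^ (2 * k) * u i, 0, 0, 0⟩ := by
  induction k with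
  | zero => simp
  | succ k ih =>
    rw [show 2 * (k + 1) = 2 * k + 1 + 1 by ring, pow_succ', pow_succ', Module.End.mul_apply,
      Module.End.mul_apply, ih, LieAlgebra.ad_apply, LieAlgebra.ad_apply]
    ext i <;> simp [derivationElement]
    ring

/-- For `V = F^m × F^m` with its standard symplectic form, the representation on `F × V × F` in
which the Heisenberg algebra acts by strictly upper triangular and `e_{2m+2}` by block diagonal
endomorphisms. -/
def symplecticRep : TwistedHeisenberg F m lam →ₗ⁅F⁆
    Module.End F (F × ((Fin m → F) × (Fin m → F)) × F) where
  toFun g :=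
    { toFun := fun w =>
        -- The corner entry of a commutator is `ω(v,v') - ω(v',v) = 2ω(v,v')`, hence the factor `2`.
        (∑ i, (g.x i * w.2.1.2 i - g.y i * w.2.1.1 i) + 2 * g.z * w.2.2,
          (fun i => g.t * lam i * w.2.1.2 i + w.2.2 * g.x i,
            fun i => g.t * lam i * w.2.1.1 i + w.2.2 * g.y i), 0)
      map_add' := fun w w' => by
        ext i
        · simp only [Prod.fst_add, Prod.snd_add, Pi.add_apply, mul_add, Finset.sum_add_distrib,
            Finset.sum_sub_distrib]
          ring
        · simp; ring
        · simp; ring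
        · simp
      map_smul' := fun c w => by
        ext i
        · simp only [Prod.smul_fst, Prod.smul_snd, Pi.smul_apply, smul_eq_mul, RingHom.id_apply,
            mul_add, Finset.mul_sum]
          congr 1
          · exact Finset.sum_congr rfl fun i _ => by ring
          · ring
        · simp; ring
        · simp; ring
        · simp }
  map_add' g h := by
    refine LinearMap.ext fun w => ?_
    ext i
    · simp [add_mul, mul_add, Finset.sum_add_distrib]
      ring
    · simp; ring
    · simp; ring
    · simp
  map_smul' c g := by
    refine LinearMap.ext fun w => ?_
    ext i
    · simp only [smul_x, smul_y, smul_z, Pi.smul_apply, smul_eq_mul, LinearMap.coe_mk,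
        AddHom.coe_mk, RingHom.id_apply, LinearMap.smul_apply, Prod.smul_mk, mul_add,
        Finset.mul_sum]
      congr 1
      · exact Finset.sum_congr rfl fun i _ => by ring
      · ring
    · simp; ring
    · simp; ring
    · simp
  map_lie' {g h} := by
    refine LinearMap.ext fun w => ?_
    rw [Ring.lie_def]
    ext i
    · simp only [lie_x, lie_y, lie_z, LinearMap.coe_mk, AddHom.coe_mk, LinearMap.sub_apply,
        Module.End.mul_apply, Prod.fst_sub, mul_zero, add_zero, Finset.mul_sum, Finset.sum_mul,
        ← Finset.sum_add_distrib, ← Finset.sum_sub_distrib]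
      exact Finset.sum_congr rfl fun i _ => by ring
    · simp; ring
    · simp; ring
    · simp

theorem symplecticRep_apply (g : TwistedHeisenberg F m lam)
    (w : F × ((Fin m → F) × (Fin m → F)) × F) :
    symplecticRep g w =
      (∑ i, (g.x i * w.2.1.2 i - g.y i * w.2.1.1 i) + 2 * g.z * w.2.2,
        (fun i => g.t * lam i * w.2.1.2 i + w.2.2 * g.x i,
          fun i => g.t * lam i * w.2.1.1 i + w.2.2 * g.y i), 0) := rfl

theorem symplecticRep_injective (hm : 1 ≤ m) (h2 : (2 : F) ≠ 0) :
    Function.Injective (symplecticRep (F := F) (m := m) (lam := lam)) := by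
  refine (injective_iff_map_eq_zero _).2 fun g hg => ?_
  have hV := LinearMap.congr_fun hg (0, (fun _ => 1, fun _ => 0), 0)
  have h1 := LinearMap.congr_fun hg (0, 0, 1)
  rw [symplecticRep_apply] at hV h1
  simp only [LinearMap.zero_apply, Prod.mk_eq_zero, funext_iff] at hV h1
  ext i
  · simpa using h1.2.1.1 i
  · simpa using h1.2.1.2 i
  · simpa [h2] using h1.1
  · simpa using hV.2.1.2 ⟨0, hm⟩

/-- The n-th power of the block matrix has entries `ω(v, (tD)^(n-1) ·)`, `ω(v, (tD)^(n-2) v)`,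
`(tD)^n` and `(tD)^(n-1) v`; for odd `n` the corner is a sum of `xᵢ² - yᵢ²` terms. -/
theorem symplecticRep_pow_odd (g : TwistedHeisenberg F m lam) (k : ℕ)
    (w : F × ((Fin m → F) × (Fin m → F)) × F) :
    (symplecticRep g ^ (2 * k + 3)) w =
      (∑ i, (g.t ^ (2 * k + 2) * (lam i : F) ^ (2 * k + 2) *
            (g.x i * w.2.1.2 i - g.y i * w.2.1.1 i) +
          w.2.2 * g.t ^ (2 * k + 1) * ((lam i : F) ^ (2 * k + 1) * (g.x i ^ 2 - g.y i ^ 2))),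
        (fun i => g.t ^ (2 * k + 3) * (lam i : F) ^ (2 * k + 3) * w.2.1.2 i +
            w.2.2 * g.t ^ (2 * k + 2) * (lam i : F) ^ (2 * k + 2) * g.x i,
          fun i => g.t ^ (2 * k + 3) * (lam i : F) ^ (2 * k + 3) * w.2.1.1 i +
            w.2.2 * g.t ^ (2 * k + 2) * (lam i : F) ^ (2 * k + 2) * g.y i), 0) := by
  induction k with
  | zero =>
    rw [mul_zero, zero_add, pow_succ, pow_two]
    simp only [Module.End.mul_apply, symplecticRep_apply]
    ext i
    · simp only [mul_zero, add_zero, zero_mul]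
      exact Finset.sum_congr rfl fun i _ => by ring
    · ring
    · ring
    · rfl
  | succ k ih =>
    rw [show 2 * (k + 1) + 3 = 2 * k + 3 + 1 + 1 by ring, pow_succ', pow_succ',
      Module.End.mul_apply, Module.End.mul_apply, ih]
    simp only [symplecticRep_apply]
    ext i
    · simp only [mul_zero, add_zero, zero_mul]
      exact Finset.sum_congr rfl fun i _ => by ring
    · ring
    · ring
    · rfl

/-- The `[p]`-operator of the twisted Heisenberg algebra when `λᵢᵖ⁻¹ = c` for all `i`. -/
def pOperator (p : ℕ) (c : F) (g : TwistedHeisenberg F m lam) : TwistedHeisenberg F m lam where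
  x := fun i => g.t ^ (p - 1) * c * g.x i
  y := fun i => g.t ^ (p - 1) * c * g.y i
  z := 2⁻¹ * g.t ^ (p - 2) * ∑ i, (lam i : F) ^ (p - 2) * (g.x i ^ 2 - g.y i ^ 2)
  t := c * g.t ^ p

theorem symplecticRep_pOperator {k : ℕ} {c : F} (h2 : (2 : F) ≠ 0)
    (hc : ∀ i, (lam i : F) ^ (2 * k + 2) = c) (g : TwistedHeisenberg F m lam) :
    symplecticRep (pOperator (2 * k + 3) c g) = symplecticRep g ^ (2 * k + 3) := by
  refine LinearMap.ext fun w => ?_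
  rw [symplecticRep_pow_odd, symplecticRep_apply]
  simp only [pOperator, pow_succ _ (2 * k + 2), hc,
    show 2 * k + 3 - 1 = 2 * k + 2 by omega, show 2 * k + 3 - 2 = 2 * k + 1 by omega]
  ext i
  · dsimp only
    rw [Finset.sum_add_distrib]
    congr 1
    · exact Finset.sum_congr rfl fun i _ => by ring
    · rw [← Finset.mul_sum]
      field_simp
  · ring
  · ring
  · rfl

end TwistedHeisenberg

open TwistedHeisenberg in
theorem mainTheorem3 (F : Type*) [Field F] (p : ℕ) (hp : p.Prime) [CharP F p]
    (m : ℕ) (hm : 1 ≤ m) (lam : Fin m → Fˣ) :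
    IsRestrictable F (TwistedHeisenberg F m lam) p ↔
      2 < p ∧ ∀ i j : Fin m, lam i ^ (p - 1) = lam j ^ (p - 1) := by
  constructor
  · rintro ⟨φ, hφ⟩
    have had (u : Fin m → F) := LinearMap.congr_fun (hφ.ad_pow derivationElement) ⟨u, 0, 0, 0⟩
    rcases hp.eq_two_or_odd' with rfl | ⟨k, rfl⟩
    -- The `x`-part of the bracket vanishes, but `D²` gives `λᵢ² ≠ 0`.
    · have h := had 1
      rw [← mul_one 2, ad_derivationElement_pow_even, LieAlgebra.ad_apply] at h
      have := congrFun (congrArg TwistedHeisenberg.x h) ⟨0, hm⟩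
      simp at this
    · have hk : k ≠ 0 := by rintro rfl; exact hp.ne_one rfl
      refine ⟨by omega, ?_⟩
      have key (i : Fin m) : (lam i : F) ^ (2 * k) = (φ derivationElement).t := by
        have h := had 1
        rw [pow_succ', Module.End.mul_apply, ad_derivationElement_pow_even, LieAlgebra.ad_apply,
          LieAlgebra.ad_apply] at h
        simpa [derivationElement] using congrFun (congrArg TwistedHeisenberg.y h) i
      intro i j
      ext
      simp [key]
  · rintro ⟨hp2, hlam⟩
    obtain ⟨k, rfl⟩ : ∃ k, p = 2 * k + 3 := by
      obtain ⟨k, hk⟩ := hp.odd_of_ne_two hp2.ne'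
      exact ⟨k - 1, by omega⟩
    have h2 : (2 : F) ≠ 0 := Ring.two_ne_zero <| by
      rw [ringChar.eq F (2 * k + 3)]; omega
    refine ⟨_, symplecticRep.isPOperator_of_injective hp (symplecticRep_injective hm h2)
      (symplecticRep_pOperator (c := (lam ⟨0, hm⟩ : F) ^ (2 * k + 2)) h2 fun i => ?_)⟩
    exact_mod_cast congrArg Units.val (hlam i ⟨0, hm⟩)
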